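/- **Setting.** Let $0\le a_1\le a_2$ with $a_2>0$, and let $N_1,N_2$ be two copies of $(0,\infty)$. For real $\lambda$ put $\xi_k(\lambda)=\sqrt{\lambda-a_k}$ (with $\sqrt{-r}=-i\sqrt r$ for $r>0$), $s_1=-\xi_2/\xi_1$, $s_2=-\xi_1/\xi_2$, and let $F^{-,j}_\lambda$ be the function on $N_1\cup N_2$ that equals $\cos(\xi_j(\lambda)x)-i\,s_j(\lambda)\sin(\xi_j(\lambda)x)$ on $N_j$ and $e^{-i\xi_k(\lambda)x}$ on $N_k$, $k\ne j$. Let $q_j(\lambda)=\xi_j(\lambda)/|\xi_1(\lambda)+\xi_2(\lambda)|^2$ for $\lambda>a_j$ and $q_j(\lambda)=0$ otherwise. Let $V:L^2(N_1)\times L^2(N_2)\to L^2((a_1,\infty),q_1\,d\lambda)\times L^2((a_2,\infty),q_2\,d\lambda)$ be the continuous extension of $(V\phi)_j(\lambda)=\sum_{k=1}^{2}\int_{N_k}\phi_k(x)\,\overline{F^{-,j}_{\lambda}(x)}\,dx$, $\phi\in C_c^\infty(N_1)\times C_c^\infty(N_2)$. Let $0<\alpha<\beta<1$ and let $\psi\in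 C^2_c((\alpha,\beta))$ be complex-valued with $\|\psi\|_\infty=1$. Let $u_0\in L^2(N_1)\times L^2(N_2)$ satisfy $(Vu_0)_2\equiv0$ and $(Vu_0)_1(\lambda)=\psi(\lambda-a_2)$. For $t,x>0$ define $$u_+(t,x)=\int_{a_2+\alpha}^{a_2+\beta}e^{i\sqrt\lambda\,t}\,q_1(\lambda)\,e^{-i\xi_2(\lambda)x}\,(Vu_0)_1(\lambda)\,d\lambda ,$$ and, for $t>x>0$, $$H(t,x,u_0)=e^{-i\varphi(p_0,t,x)}(2i\pi)^{1/2}a_2^{3/4}\,h_1(t,x)\,h_2(t,x)\,(Vu_0)_1(a_2+p_0^2),$$ where $\varphi(p,t,x)=\sqrt{a_2+p^2}\,t-px$, $p_0=\sqrt{a_2x^2/(t^2-x^2)}$, $$h_1=\left(\frac{(t/x)^2}{(t/x)^2-1}\right)^{3/4},\qquad h_2=\frac{\sqrt{(a_2-a_1)((t/x)^2-1)+a_2}}{\Bigl(\sqrt{(a_2-a_1)((t/x)^2-1)+a_2}+\sqrt{a_2}\Bigr)^2}.$$ **Theorem.** Suppose that $\alpha<\alpha'<\beta'<\beta$ and that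 $\psi$ is real-valued with $\psi\ge m>0$ on $[\alpha',\beta']$. Put $$f(a_1,a_2,\alpha)=\sqrt{2\pi}\,a_2^{3/4}\Bigl(\frac{\alpha}{a_2}+1\Bigr)^{3/4}\frac1{\sqrt{a_2}}\,\sqrt{\frac{a_2-a_1}{\alpha}+1}\,\Biggl(\sqrt{\frac{a_2-a_1}{\alpha}+1}+1\Biggr)^{-2}.$$ (i) For all $t,x>0$ with $$\sqrt{\frac{a_2+\beta'}{\beta'}}\le\frac tx\le\sqrt{\frac{a_2+\alpha'}{\alpha'}}\qquad(*)$$ one has $|H(t,x,u_0)|\ge f(a_1,a_2,\alpha)\,m$. Moreover, for fixed $a_1$ and $\alpha$, $f(a_1,a_2,\alpha)\sim\sqrt{2\pi\alpha}\;a_2^{-1/4}$ as $a_2\to\infty$. (ii) For every $\varepsilon>0$ there is $t_0>0$ such that for all $t>t_0$ and all $x>0$ satisfying $(*)$, $$|u_+(t,x)|\ge\bigl(f(a_1,a_2,\alpha)\,m-\varepsilon\bigr)\,t^{-1/2}.$$ -/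

import Mathlib

open MeasureTheory Filter Asymptotics
open scoped Topology ContDiff ENNReal

noncomputable section

namespace KleinGordon

/-! Two half-lines `N₁, N₂` (each identified with `(0, ∞)`) are indexed by `Fin 2`: the index `0`
stands for the branch `N₁` and the index `1` for `N₂`.  The potentials are `a 0`, `a 1`. -/

/-- `ξ(l) = √(l - c)` for real `l`, where the complex square root takes arguments in `[-π, π)`,
so that the root of a negative number `-r` is `-i √r`. -/
def xi (c l : ℝ) : ℂ :=
  if c ≤ l then (Real.sqrt (l - c) : ℂ) else -Complex.I * (Real.sqrt (c - l) : ℂ)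

/-- `s_j(l) = - ξ_{j'}(l) / ξ_j(l)`, where `j' = 1 - j` is the other branch. -/
def sCoeff (a : Fin 2 → ℝ) (j : Fin 2) (l : ℝ) : ℂ :=
  -(xi (a (1 - j)) l / xi (a j) l)

/-- The generalized eigenfunction `F_l^{-,j}` on the branch `k`. -/
def eigenfun (a : Fin 2 → ℝ) (j k : Fin 2) (l x : ℝ) : ℂ :=
  if k = j then
    Complex.cos (xi (a j) l * x) - Complex.I * sCoeff a j l * Complex.sin (xi (a j) l * x)
  else
    Complex.exp (-Complex.I * xi (a k) l * x)

/-- The weight `q_j(l) = ξ_j(l) / |ξ₁(l) + ξ₂(l)|²` for `l > a_j`, and `0` otherwise. -/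
def weight (a : Fin 2 → ℝ) (j : Fin 2) (l : ℝ) : ℝ :=
  if a j < l then Real.sqrt (l - a j) / ‖xi (a 0) l + xi (a 1) l‖ ^ 2 else 0

/-- The measure `q_j(l) dl` on `(a_j, ∞)`. -/
def weightMeasure (a : Fin 2 → ℝ) (j : Fin 2) : Measure ℝ :=
  (volume.restrict (Set.Ioi (a j))).withDensity (fun l => ENNReal.ofReal (weight a j l))

/-- The Hilbert space `L²(N₁) × L²(N₂)`. -/
abbrev StateSpace : Type :=
  Fin 2 → Lp ℂ 2 (volume.restrict (Set.Ioi (0 : ℝ)))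

/-- Test functions: pairs in `C_c^∞(N₁) × C_c^∞(N₂)`. -/
def IsTestPair (φ : Fin 2 → ℝ → ℂ) : Prop :=
  ∀ k, ContDiff ℝ ∞ (φ k) ∧ HasCompactSupport (φ k) ∧ tsupport (φ k) ⊆ Set.Ioi 0

/-- The transform on test functions: `(V φ)_j(l) = ∑_k ∫_{N_k} φ_k(x) conj(F_{l,k}^{-,j}(x)) dx`. -/
def transformTest (a : Fin 2 → ℝ) (φ : Fin 2 → ℝ → ℂ) (j : Fin 2) (l : ℝ) : ℂ :=
  ∑ k, ∫ x in Set.Ioi (0 : ℝ), φ k x * (starRingEnd ℂ) (eigenfun a j k l x)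

/-- `w` represents `V u`, where `V : L²(N₁) × L²(N₂) → L²((a₁,∞), q₁) × L²((a₂,∞), q₂)` is the
extension by continuity of the transform on test functions. -/
def IsTransform (a : Fin 2 → ℝ) (u : StateSpace) (w : Fin 2 → ℝ → ℂ) : Prop :=
  (∀ j, MemLp (w j) 2 (weightMeasure a j)) ∧
  ∃ φ : ℕ → Fin 2 → ℝ → ℂ, (∀ n, IsTestPair (φ n)) ∧
    (∀ k, Tendsto (fun n => eLpNorm (fun x => φ n k x - u k x) 2
      (volume.restrict (Set.Ioi (0 : ℝ)))) atTop (𝓝 0)) ∧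
    (∀ j, Tendsto (fun n => eLpNorm (fun l => transformTest a (φ n) j l - w j l) 2
      (weightMeasure a j)) atTop (𝓝 0))

/-- `u_+(t,x) = ∫_{lmin}^{lmax} e^{i √l t} q₁(l) e^{-i ξ₂(l) x} w(l) dl`, with `w = (V u₀)₁`
supported in `[lmin, lmax]`. -/
def uPlus (a₁ a₂ lmin lmax : ℝ) (w : ℝ → ℂ) (t x : ℝ) : ℂ :=
  ∫ l in lmin..lmax, Complex.exp (Complex.I * Real.sqrt l * t) * (weight ![a₁, a₂] 0 l : ℂ) *
    Complex.exp (-Complex.I * xi a₂ l * x) * w l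

/-- The phase `φ(p,t,x) = √(a₂ + p²) t - p x`. -/
def phase (a₂ p t x : ℝ) : ℝ := Real.sqrt (a₂ + p ^ 2) * t - p * x

/-- The stationary point `p₀` of the phase. -/
def p0 (a₂ t x : ℝ) : ℝ := Real.sqrt (a₂ * x ^ 2 / (t ^ 2 - x ^ 2))

def h1 (t x : ℝ) : ℝ := ((t / x) ^ 2 / ((t / x) ^ 2 - 1)) ^ (3 / 4 : ℝ)

def h2 (a₁ a₂ t x : ℝ) : ℝ :=
  Real.sqrt ((a₂ - a₁) * ((t / x) ^ 2 - 1) + a₂) /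
    (Real.sqrt ((a₂ - a₁) * ((t / x) ^ 2 - 1) + a₂) + Real.sqrt a₂) ^ 2

/-- The coefficient `H(t,x,u₀)`, with `w = (V u₀)₁`. -/
def coeffH (a₁ a₂ : ℝ) (w : ℝ → ℂ) (t x : ℝ) : ℂ :=
  Complex.exp (-Complex.I * phase a₂ (p0 a₂ t x) t x) *
    (2 * Complex.I * Real.pi) ^ (1 / 2 : ℂ) * ((a₂ ^ (3 / 4 : ℝ) : ℝ) : ℂ) *
    (h1 t x : ℂ) * (h2 a₁ a₂ t x : ℂ) * w (a₂ + p0 a₂ t x ^ 2)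

/-- The constant in the lower estimates. -/
def lowerConst (a₁ a₂ α : ℝ) : ℝ :=
  Real.sqrt (2 * Real.pi) * a₂ ^ (3 / 4 : ℝ) * (α / a₂ + 1) ^ (3 / 4 : ℝ) * (1 / Real.sqrt a₂) *
    Real.sqrt ((a₂ - a₁) / α + 1) * ((Real.sqrt ((a₂ - a₁) / α + 1) + 1) ^ 2)⁻¹

/-- The space-time cone `√((a₂+β)/β) ≤ t/x ≤ √((a₂+α)/α)`, with `t, x > 0`. -/
def InCone (a₂ α β t x : ℝ) : Prop :=
  0 < t ∧ 0 < x ∧ Real.sqrt ((a₂ + β) / β) ≤ t / x ∧ t / x ≤ Real.sqrt ((a₂ + α) / α)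

end KleinGordon

end

noncomputable section

namespace KleinGordon

/-! The Klein-Gordon phase becomes exactly quadratic after two substitutions. With `l = a₂ cosh² θ`
and `(t, x) = ρ (cosh θ₀, sinh θ₀)` the addition formula turns `√l t - ξ₂ x` into `√a₂ ρ cosh (θ -
θ₀)` (`uPlus_eq_integral_cosh`), and `θ = θ₀ + 2 arsinh y` turns `cosh (θ - θ₀)` into `1 + 2 y²`
(`integral_cosh_phase_eq`). The stationary point enters only as a translation of a fixed `C¹`
compactly supported amplitude, so sup norms of that amplitude and its derivative give estimates
uniform over the cone.

For the phase `σ y²`, a multiple of `exp (-y²)` carries the value of the amplitude at `0` and is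
integrated in closed form. The remainder vanishes at `0`, and integration by parts bounds it by
`quadraticRate σ / √σ`, where `quadraticRate σ → 0` by dominated convergence
(`sqrt_mul_norm_integral_sub_le`).

The modulus of `H` is half of the true leading coefficient (`norm_coeffH_eq_amplitude`), so the
model integral is needed only up to a factor 2. Finally `|H| ≥ f m` on the cone because each factor
of `|H|` is bounded below by its value at `p₀² = α`, the last one by monotonicity of `r / (r + 1)²`
for `r ≥ 1` (`lowerConst_mul_le_norm_coeffH`). -/

/-! ### Oscillatory integrals with quadratic phase. -/

/-- The scale-invariant rate with which a quadratic oscillation damps an amplitude vanishing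
at the stationary point. -/
def quadraticRate (σ : ℝ) : ℝ :=
  ∫ y : ℝ, Real.sqrt σ * |y| / Real.sqrt (1 + (2 * σ * y ^ 2) ^ 2) * (1 + y ^ 2)⁻¹

/-- With `z = 2σy²` this is `z / 2 ≤ 1 + z²`. It gives the domination by `(1 + y²)⁻¹`, uniform in
`σ`. -/
lemma sqrt_mul_abs_div_le {σ : ℝ} (hσ : 0 < σ) (y : ℝ) :
    Real.sqrt σ * |y| / Real.sqrt (1 + (2 * σ * y ^ 2) ^ 2) ≤ 1 := by
  rw [div_le_one (by positivity)]
  apply Real.le_sqrt_of_sq_le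
  rw [mul_pow, Real.sq_sqrt hσ.le, sq_abs]
  nlinarith [sq_nonneg (2 * σ * y ^ 2 - 1), mul_nonneg hσ.le (sq_nonneg y)]

lemma integrable_quadraticRate {σ : ℝ} (hσ : 0 < σ) :
    Integrable fun y : ℝ =>
      Real.sqrt σ * |y| / Real.sqrt (1 + (2 * σ * y ^ 2) ^ 2) * (1 + y ^ 2)⁻¹ := by
  refine integrable_inv_one_add_sq.mono' ?_ (ae_of_all _ fun y => ?_)
  · refine Continuous.aestronglyMeasurable ?_
    refine Continuous.mul (Continuous.div (by fun_prop) (by fun_prop) fun y => ?_)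
      (Continuous.inv₀ (by fun_prop) fun y => ?_) <;> positivity
  · rw [Real.norm_of_nonneg (by positivity)]
    exact mul_le_of_le_one_left (by positivity) (sqrt_mul_abs_div_le hσ y)

lemma quadraticRate_nonneg (σ : ℝ) : 0 ≤ quadraticRate σ :=
  integral_nonneg fun y => by positivity

/-- Dominated convergence: for `y ≠ 0` the oscillatory factor is at most `1 / (2 √σ |y|)`. -/
lemma tendsto_quadraticRate : Tendsto quadraticRate atTop (𝓝 0) := by
  have h : (0 : ℝ) = ∫ y : ℝ, (0 : ℝ) := by simp
  rw [h]
  refine tendsto_integral_filter_of_dominated_convergence (fun y => (1 + y ^ 2)⁻¹) ?_ ?_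
    integrable_inv_one_add_sq ?_
  · filter_upwards [eventually_gt_atTop 0] with σ hσ
    exact (integrable_quadraticRate hσ).aestronglyMeasurable
  · filter_upwards [eventually_gt_atTop 0] with σ hσ
    refine ae_of_all _ fun y => ?_
    rw [Real.norm_of_nonneg (by positivity)]
    exact mul_le_of_le_one_left (by positivity) (sqrt_mul_abs_div_le hσ y)
  · refine ae_of_all _ fun y => ?_
    rw [show (0 : ℝ) = 0 * (1 + y ^ 2)⁻¹ by simp]
    refine Tendsto.mul_const _ ?_
    by_cases hy : y = 0
    · simp [hy]
    have hlim : Tendsto (fun σ : ℝ => (Real.sqrt σ)⁻¹ * (1 / (2 * |y|))) atTop (𝓝 0) := by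
      simpa using (tendsto_inv_atTop_zero.comp Real.tendsto_sqrt_atTop).mul_const (1 / (2 * |y|))
    refine squeeze_zero' (Eventually.of_forall fun σ => by positivity) ?_ hlim
    filter_upwards [eventually_gt_atTop 0] with σ hσ
    have hy' : 0 < |y| := abs_pos.mpr hy
    have hs : 0 < Real.sqrt σ := Real.sqrt_pos.mpr hσ
    have h1 : 2 * σ * |y| ^ 2 ≤ Real.sqrt (1 + (2 * σ * y ^ 2) ^ 2) := by
      apply Real.le_sqrt_of_sq_le
      rw [sq_abs]; linarith
    calc Real.sqrt σ * |y| / Real.sqrt (1 + (2 * σ * y ^ 2) ^ 2)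
        ≤ Real.sqrt σ * |y| / (2 * σ * |y| ^ 2) := by gcongr
      _ = (Real.sqrt σ)⁻¹ * (1 / (2 * |y|)) := by
        have h2 : σ = Real.sqrt σ * Real.sqrt σ := (Real.mul_self_sqrt hσ.le).symm
        rw [h2, Real.sqrt_mul_self hs.le]
        field_simp

lemma norm_exp_I_mul_ofReal_eq (r : ℝ) : ‖Complex.exp (Complex.I * r)‖ = 1 := by
  rw [mul_comm, Complex.norm_exp_ofReal_mul_I]

lemma norm_one_add_I_mul (z : ℝ) : ‖1 + Complex.I * z‖ = Real.sqrt (1 + z ^ 2) := by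
  rw [Complex.norm_def, Complex.normSq_apply]
  simp
  ring_nf

lemma one_add_I_mul_ne_zero (z : ℝ) : (1 + Complex.I * z : ℂ) ≠ 0 := by
  rw [← norm_ne_zero_iff, norm_one_add_I_mul]
  positivity

/-- Integration by parts against a quadratic phase for an amplitude vanishing at the stationary
point. -/
lemma sqrt_mul_norm_integral_le {σ B : ℝ} (hσ : 0 < σ) {M M' : ℝ → ℂ}
    (hM : ∀ y, HasDerivAt M (M' y) y) (hM'c : Continuous M') (hMi : Integrable M)
    (hMB : ∀ y, ‖M y‖ ≤ B * |y| * (1 + y ^ 2)⁻¹) (hM'B : ∀ y, ‖M' y‖ ≤ B * (1 + y ^ 2)⁻¹) :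
    Real.sqrt σ * ‖∫ y : ℝ, M y * Complex.exp (Complex.I * (σ * y ^ 2 : ℝ))‖ ≤
      3 * B * quadraticRate σ := by
  have hs : 0 < Real.sqrt σ := Real.sqrt_pos.mpr hσ
  have hMc : Continuous M := continuous_iff_continuousAt.mpr fun y => (hM y).continuousAt
  -- Since `(y e)' = D e` and `D` has no zero, the parts `M / D` and `y e` avoid dividing by the
  -- derivative of the phase, which vanishes at `0`.
  set D : ℝ → ℂ := fun y => 1 + Complex.I * (2 * σ * y ^ 2 : ℝ) with hD
  have hD0 : ∀ y, D y ≠ 0 := fun y => one_add_I_mul_ne_zero _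
  have hDn : ∀ y, ‖D y‖ = Real.sqrt (1 + (2 * σ * y ^ 2) ^ 2) := fun y => norm_one_add_I_mul _
  have hDc : Continuous D := by fun_prop
  set e : ℝ → ℂ := fun y => Complex.exp (Complex.I * (σ * y ^ 2 : ℝ)) with he
  have hen : ∀ y, ‖e y‖ = 1 := fun y => norm_exp_I_mul_ofReal_eq _
  have hec : Continuous e := by fun_prop
  have hDd : ∀ y, HasDerivAt D (Complex.I * (4 * σ * y : ℝ)) y := fun y => by
    have h : HasDerivAt (fun y : ℝ => 2 * σ * y ^ 2) (4 * σ * y) y := by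
      refine ((hasDerivAt_pow 2 y).const_mul (2 * σ)).congr_deriv ?_
      simp; ring
    exact (h.ofReal_comp.const_mul Complex.I).const_add 1
  have hed : ∀ y, HasDerivAt e (e y * (Complex.I * (2 * σ * y : ℝ))) y := fun y => by
    have h : HasDerivAt (fun y : ℝ => σ * y ^ 2) (2 * σ * y) y := by
      refine ((hasDerivAt_pow 2 y).const_mul σ).congr_deriv ?_
      simp; ring
    exact (h.ofReal_comp.const_mul Complex.I).cexp
  set u : ℝ → ℂ := fun y => M y / D y with hu
  set u' : ℝ → ℂ := fun y =>
    (M' y * D y - M y * (Complex.I * (4 * σ * y : ℝ))) / D y ^ 2 with hu'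
  set v : ℝ → ℂ := fun y => (y : ℂ) * e y with hv
  set v' : ℝ → ℂ := fun y => D y * e y with hv'
  have hud : ∀ y, HasDerivAt u (u' y) y := fun y => (hM y).div (hDd y) (hD0 y)
  have hvd : ∀ y, HasDerivAt v (v' y) y := fun y => by
    refine ((hasDerivAt_id y).ofReal_comp.mul (hed y)).congr_deriv ?_
    simp only [hv', hD, id]
    push_cast
    ring
  have huv' : ∀ y, u y * v' y = M y * e y := fun y => by
    simp only [hu, hv']
    field_simp [hD0 y]
  -- The 3 is one `‖D‖` from the term with `M'` and two from the term with `D'`, as `|y D'| = 2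
  -- (2σy²) ≤ 2 ‖D‖`.
  have hbound : ∀ y, ‖u' y * v y‖ ≤ 3 * B * (Real.sqrt σ)⁻¹ *
      (Real.sqrt σ * |y| / Real.sqrt (1 + (2 * σ * y ^ 2) ^ 2) * (1 + y ^ 2)⁻¹) := fun y => by
    have hS : 0 < Real.sqrt (1 + (2 * σ * y ^ 2) ^ 2) := by positivity
    have hz : 2 * σ * y ^ 2 ≤ Real.sqrt (1 + (2 * σ * y ^ 2) ^ 2) :=
      Real.le_sqrt_of_sq_le (by linarith)
    set S := Real.sqrt (1 + (2 * σ * y ^ 2) ^ 2) with hSdef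
    have hB : 0 ≤ B := by simpa using (norm_nonneg _).trans (hM'B 0)
    have h1 : ‖M' y * D y - M y * (Complex.I * (4 * σ * y : ℝ))‖ ≤
        3 * B * (1 + y ^ 2)⁻¹ * S := by
      calc _ ≤ ‖M' y * D y‖ + ‖M y * (Complex.I * (4 * σ * y : ℝ))‖ := norm_sub_le _ _
        _ = ‖M' y‖ * S + ‖M y‖ * (4 * σ * |y|) := by
          rw [norm_mul, norm_mul, norm_mul, hDn, Complex.norm_I, Complex.norm_real, one_mul,
            norm_mul, Real.norm_of_nonneg (by positivity : 0 ≤ 4 * σ), Real.norm_eq_abs]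
        _ ≤ B * (1 + y ^ 2)⁻¹ * S + B * |y| * (1 + y ^ 2)⁻¹ * (4 * σ * |y|) := by
          gcongr
          · exact hM'B y
          · exact hMB y
        _ = B * (1 + y ^ 2)⁻¹ * (S + 2 * (2 * σ * |y| ^ 2)) := by ring
        _ ≤ B * (1 + y ^ 2)⁻¹ * (S + 2 * S) := by rw [sq_abs]; gcongr
        _ = _ := by ring
    calc ‖u' y * v y‖
        = ‖M' y * D y - M y * (Complex.I * (4 * σ * y : ℝ))‖ / S ^ 2 * |y| := by
          simp only [hu', hv]
          rw [norm_mul, norm_div, norm_pow, hDn, norm_mul, hen, mul_one, Complex.norm_real,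
            Real.norm_eq_abs]
      _ ≤ 3 * B * (1 + y ^ 2)⁻¹ * S / S ^ 2 * |y| := by gcongr
      _ = _ := by field_simp
  have hu'v : Integrable (u' * v) := by
    refine ((integrable_quadraticRate hσ).const_mul (3 * B * (Real.sqrt σ)⁻¹)).mono' ?_
      (ae_of_all _ hbound)
    refine Continuous.aestronglyMeasurable ?_
    exact (Continuous.div (by fun_prop) (by fun_prop) fun y => pow_ne_zero _ (hD0 y)).mul
      (by fun_prop)
  have huv : Integrable (u * v) := by
    refine (hMi.norm.const_mul ((Real.sqrt σ)⁻¹)).mono' ?_ (ae_of_all _ fun y => ?_)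
    · exact ((hMc.div hDc hD0).mul (by fun_prop)).aestronglyMeasurable
    · have h := sqrt_mul_abs_div_le hσ y
      calc ‖(u * v) y‖ = ‖M y‖ * (Real.sqrt σ)⁻¹ *
            (Real.sqrt σ * |y| / Real.sqrt (1 + (2 * σ * y ^ 2) ^ 2)) := by
            simp only [Pi.mul_apply, hu, hv]
            rw [norm_mul, norm_div, hDn, norm_mul, hen, mul_one, Complex.norm_real,
              Real.norm_eq_abs]
            field_simp
        _ ≤ ‖M y‖ * (Real.sqrt σ)⁻¹ * 1 := by gcongr
        _ = _ := by ring
  have hint : Integrable (u * v') := by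
    refine hMi.norm.mono' ?_ (ae_of_all _ fun y => ?_)
    · exact ((hMc.div hDc hD0).mul (hDc.mul hec)).aestronglyMeasurable
    · rw [Pi.mul_apply, huv', norm_mul, hen, mul_one]
  have hparts := integral_mul_deriv_eq_deriv_mul_of_integrable
    (fun y _ => hud y) (fun y _ => hvd y) hint hu'v huv
  simp only [huv'] at hparts
  rw [hparts, norm_neg]
  calc Real.sqrt σ * ‖∫ y : ℝ, u' y * v y‖
      ≤ Real.sqrt σ * ∫ y : ℝ, 3 * B * (Real.sqrt σ)⁻¹ *
        (Real.sqrt σ * |y| / Real.sqrt (1 + (2 * σ * y ^ 2) ^ 2) * (1 + y ^ 2)⁻¹) := by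
        gcongr
        exact norm_integral_le_of_norm_le ((integrable_quadraticRate hσ).const_mul _)
          (ae_of_all _ hbound)
    _ = 3 * B * quadraticRate σ := by
      rw [integral_const_mul, quadraticRate]
      field_simp

lemma exp_neg_sq_le (y : ℝ) : Real.exp (-y ^ 2) ≤ (1 + y ^ 2)⁻¹ := by
  rw [Real.exp_neg]
  gcongr
  linarith [Real.add_one_le_exp (y ^ 2)]

/-- Follows from `2|y| ≤ 1 + y²` and `(1 + y²)² ≤ 2 exp (y²)`, the latter by the Taylor bound of
order two. -/
lemma two_mul_abs_mul_exp_neg_sq_le (y : ℝ) :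
    2 * |y| * Real.exp (-y ^ 2) ≤ 2 * (1 + y ^ 2)⁻¹ := by
  rw [Real.exp_neg, ← div_eq_mul_inv, ← div_eq_mul_inv, div_le_div_iff₀ (by positivity)
    (by positivity)]
  have h := Real.quadratic_le_exp_of_nonneg (sq_nonneg y)
  have h2 : 2 * |y| ≤ 1 + y ^ 2 := by nlinarith [sq_nonneg (|y| - 1), sq_abs y]
  have h3 : 2 * |y| * (1 + y ^ 2) ≤ (1 + y ^ 2) * (1 + y ^ 2) := by gcongr
  nlinarith

/-- Stationary phase for the quadratic phase `σ y²`, with an error controlled by weighted `C¹`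
bounds of the amplitude. -/
lemma sqrt_mul_norm_integral_sub_le {σ B : ℝ} (hσ : 0 < σ) {K K' : ℝ → ℂ}
    (hK : ∀ y, HasDerivAt K (K' y) y) (hK'c : Continuous K') (hKi : Integrable K)
    (hKB : ∀ y, ‖K y‖ ≤ B * (Real.sqrt (1 + y ^ 2))⁻¹)
    (hK'B : ∀ y, ‖K' y‖ ≤ B * (1 + y ^ 2)⁻¹) :
    Real.sqrt σ * ‖(∫ y : ℝ, K y * Complex.exp (Complex.I * (σ * y ^ 2 : ℝ))) -
      K 0 * (Real.pi / (1 - Complex.I * σ)) ^ (1 / 2 : ℂ)‖ ≤ 18 * B * quadraticRate σ := by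
  have hK0 : ‖K 0‖ ≤ B := by simpa using hKB 0
  have hB : 0 ≤ B := (norm_nonneg _).trans hK0
  set g : ℝ → ℂ := fun y => ((Real.exp (-y ^ 2) : ℝ) : ℂ) with hg
  have hgn : ∀ y, ‖g y‖ = Real.exp (-y ^ 2) := fun y => by
    simp only [hg]
    rw [Complex.norm_real, Real.norm_of_nonneg (Real.exp_pos _).le]
  have hgd : ∀ y, HasDerivAt g ((Real.exp (-y ^ 2) * (-(2 * y)) : ℝ) : ℂ) y := fun y => by
    have h : HasDerivAt (fun y : ℝ => -y ^ 2) (-(2 * y)) y := by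
      simpa using (hasDerivAt_pow 2 y).fun_neg
    exact h.exp.ofReal_comp
  have hgi : Integrable g := by
    have h := (integrable_exp_neg_mul_sq (b := 1) one_pos).ofReal (𝕜 := ℂ)
    simpa [hg] using h
  have hgauss : ∫ y : ℝ, g y * Complex.exp (Complex.I * (σ * y ^ 2 : ℝ)) =
      (Real.pi / (1 - Complex.I * σ)) ^ (1 / 2 : ℂ) := by
    rw [← integral_gaussian_complex (b := 1 - Complex.I * σ) (by simp)]
    congr 1 with y
    simp only [hg, Complex.ofReal_exp]
    rw [← Complex.exp_add]
    congr 1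
    push_cast
    ring
  set M : ℝ → ℂ := fun y => K y - K 0 * g y with hMdef
  set M' : ℝ → ℂ := fun y => K' y - K 0 * ((Real.exp (-y ^ 2) * (-(2 * y)) : ℝ) : ℂ) with hM'def
  have hM : ∀ y, HasDerivAt M (M' y) y := fun y => (hK y).sub ((hgd y).const_mul _)
  have hM'B : ∀ y, ‖M' y‖ ≤ 3 * B * (1 + y ^ 2)⁻¹ := fun y => by
    calc ‖M' y‖ ≤ ‖K' y‖ + ‖K 0 * ((Real.exp (-y ^ 2) * (-(2 * y)) : ℝ) : ℂ)‖ := norm_sub_le _ _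
      _ = ‖K' y‖ + ‖K 0‖ * (2 * |y| * Real.exp (-y ^ 2)) := by
        rw [norm_mul, Complex.norm_real, norm_mul, norm_neg, norm_mul,
          Real.norm_of_nonneg (Real.exp_pos _).le, Real.norm_eq_abs, Real.norm_eq_abs, abs_two]
        ring
      _ ≤ B * (1 + y ^ 2)⁻¹ + B * (2 * (1 + y ^ 2)⁻¹) := by
        exact add_le_add (hK'B y) (mul_le_mul hK0 (two_mul_abs_mul_exp_neg_sq_le y)
          (by positivity) hB)
      _ = _ := by ring
  have hMlin : ∀ y, ‖M y‖ ≤ 3 * B * |y| := fun y => by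
    have h := Convex.norm_image_sub_le_of_norm_hasDerivWithin_le (f := M) (f' := M') (C := 3 * B)
      (s := Set.univ) (x := 0) (y := y) (fun z _ => (hM z).hasDerivWithinAt)
      (fun z _ => (hM'B z).trans (mul_le_of_le_one_right (by positivity)
        (inv_le_one_of_one_le₀ (by nlinarith [sq_nonneg z])))) convex_univ trivial trivial
    have hM0 : M 0 = 0 := by simp [hMdef, hg]
    simpa [hM0] using h
  -- For `|y| ≤ 1` the linear bound costs a factor `1 + y² ≤ 2`, hence `6 = 3 · 2`; for `|y| ≥ 1`
  -- the decay of `K` and of the Gaussian suffices.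
  have hMB : ∀ y, ‖M y‖ ≤ 6 * B * |y| * (1 + y ^ 2)⁻¹ := fun y => by
    rcases le_total |y| 1 with hy | hy
    · refine (hMlin y).trans ?_
      rw [← div_eq_mul_inv, le_div_iff₀ (by positivity)]
      have : y ^ 2 ≤ 1 := by rw [← sq_abs]; exact pow_le_one₀ (abs_nonneg y) hy
      nlinarith [mul_nonneg hB (abs_nonneg y)]
    · have hT : 0 < Real.sqrt (1 + y ^ 2) := by positivity
      have hTT : Real.sqrt (1 + y ^ 2) * Real.sqrt (1 + y ^ 2) = 1 + y ^ 2 :=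
        Real.mul_self_sqrt (by positivity)
      have hT2 : Real.sqrt (1 + y ^ 2) ≤ 2 * |y| := by
        apply Real.sqrt_le_iff.mpr ⟨by positivity, ?_⟩
        nlinarith [sq_abs y]
      calc ‖M y‖ ≤ ‖K y‖ + ‖K 0 * g y‖ := norm_sub_le _ _
        _ ≤ B * (Real.sqrt (1 + y ^ 2))⁻¹ + B * (1 + y ^ 2)⁻¹ := by
          rw [norm_mul, hgn]
          gcongr
          · exact hKB y
          · exact exp_neg_sq_le y
        _ = B * (Real.sqrt (1 + y ^ 2) + 1) * (1 + y ^ 2)⁻¹ := by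
          have hT' : (Real.sqrt (1 + y ^ 2))⁻¹ = Real.sqrt (1 + y ^ 2) * (1 + y ^ 2)⁻¹ := by
            rw [eq_mul_inv_iff_mul_eq₀ (by positivity), inv_mul_eq_iff_eq_mul₀ hT.ne', hTT]
          rw [hT']; ring
        _ ≤ B * (2 * |y| + |y|) * (1 + y ^ 2)⁻¹ := by gcongr
        _ ≤ _ := by
          refine mul_le_mul_of_nonneg_right ?_ (by positivity)
          nlinarith [mul_nonneg hB (abs_nonneg y)]
  have hM'c : Continuous M' := by fun_prop
  have hMi : Integrable M := hKi.sub (hgi.const_mul _)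
  have hec : AEStronglyMeasurable (fun y : ℝ => Complex.exp (Complex.I * (σ * y ^ 2 : ℝ))) :=
    Continuous.aestronglyMeasurable (by fun_prop)
  have hei : ∀ f : ℝ → ℂ, Integrable f →
      Integrable fun y : ℝ => f y * Complex.exp (Complex.I * (σ * y ^ 2 : ℝ)) := fun f hf =>
    hf.mul_bdd (c := 1) hec (ae_of_all _ fun y => (norm_exp_I_mul_ofReal_eq _).le)
  have hmain := sqrt_mul_norm_integral_le (B := 6 * B) hσ hM hM'c hMi hMB fun y =>
    (hM'B y).trans (by gcongr; norm_num)
  have hsplit : ∫ y : ℝ, M y * Complex.exp (Complex.I * (σ * y ^ 2 : ℝ)) =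
      (∫ y : ℝ, K y * Complex.exp (Complex.I * (σ * y ^ 2 : ℝ))) -
        K 0 * (Real.pi / (1 - Complex.I * σ)) ^ (1 / 2 : ℂ) := by
    rw [← hgauss, ← integral_const_mul, ← integral_sub (hei K hKi) ((hei g hgi).const_mul _)]
    congr 1 with y
    simp only [hMdef]
    ring
  rw [← hsplit]
  calc _ ≤ 3 * (6 * B) * quadraticRate σ := hmain
    _ = _ := by ring

/-- Lower bound for the modulus of the model integral. -/
lemma sqrt_pi_div_two_le_sqrt_mul_norm {σ : ℝ} (hσ : 1 ≤ σ) :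
    Real.sqrt Real.pi / 2 ≤
      Real.sqrt σ * ‖((Real.pi / (1 - Complex.I * σ)) ^ (1 / 2 : ℂ) : ℂ)‖ := by
  have hσ0 : 0 < σ := by linarith
  -- A crude bound: the sharp limit of the right side of the goal is `√π`, and the half given up
  -- here is the one missing from `H`.
  have h1 : ‖(1 - Complex.I * σ : ℂ)‖ ≤ 2 * σ := by
    calc _ ≤ ‖(1 : ℂ)‖ + ‖(Complex.I * σ : ℂ)‖ := norm_sub_le _ _
      _ = 1 + σ := by simp [abs_of_pos hσ0]
      _ ≤ _ := by linarith
  have hne : (1 - Complex.I * σ : ℂ) ≠ 0 := by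
    intro h
    have := congrArg Complex.re h
    simp at this
  have h2 : ‖((Real.pi / (1 - Complex.I * σ)) ^ (1 / 2 : ℂ) : ℂ)‖ =
      Real.sqrt (Real.pi / ‖(1 - Complex.I * σ : ℂ)‖) := by
    rw [show (1 / 2 : ℂ) = ((1 / 2 : ℝ) : ℂ) by push_cast; rfl,
      Complex.norm_cpow_real, norm_div, Complex.norm_real, Real.norm_of_nonneg Real.pi_pos.le,
      Real.sqrt_eq_rpow]
  rw [h2, ← Real.sqrt_mul hσ0.le]
  have h4 : Real.sqrt Real.pi / 2 = Real.sqrt (Real.pi / 4) := by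
    rw [Real.sqrt_div Real.pi_pos.le, show (4 : ℝ) = 2 ^ 2 by norm_num,
      Real.sqrt_sq (by norm_num)]
  rw [h4]
  apply Real.sqrt_le_sqrt
  have hn : 0 < ‖(1 - Complex.I * σ : ℂ)‖ := norm_pos_iff.mpr hne
  rw [← mul_div_assoc, le_div_iff₀ hn]
  have := Real.pi_pos
  nlinarith

/-! ### Oscillatory integrals with hyperbolic cosine phase. -/

lemma cosh_two_mul_arsinh (y : ℝ) : Real.cosh (2 * Real.arsinh y) = 1 + 2 * y ^ 2 := by
  rw [Real.cosh_two_mul, Real.cosh_sq, Real.sinh_arsinh]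
  ring

/-- The substitution `θ = θ₀ + 2 arsinh y` turns the phase `cosh (θ - θ₀)` into `1 + 2 y²`. -/
lemma integral_cosh_phase_eq (G : ℝ → ℂ) (θ₀ τ : ℝ) :
    ∫ θ : ℝ, G θ * Complex.exp (Complex.I * (τ * Real.cosh (θ - θ₀) : ℝ)) =
      Complex.exp (Complex.I * τ) *
        ∫ y : ℝ, ((2 * (Real.sqrt (1 + y ^ 2))⁻¹ : ℝ) * G (θ₀ + 2 * Real.arsinh y)) *
          Complex.exp (Complex.I * (2 * τ * y ^ 2 : ℝ)) := by
  set f : ℝ → ℝ := fun y => θ₀ + 2 * Real.arsinh y with hf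
  have hfd : ∀ y ∈ Set.univ,
      HasDerivWithinAt f (2 * (Real.sqrt (1 + y ^ 2))⁻¹) Set.univ y := fun y _ =>
    (((Real.hasDerivAt_arsinh y).const_mul 2).const_add θ₀).hasDerivWithinAt
  have hinj : Set.InjOn f Set.univ := fun y _ z _ h => by
    have h' : Real.arsinh y = Real.arsinh z := by simp only [hf] at h; linarith
    exact Real.arsinh_injective h'
  have himg : f '' Set.univ = Set.univ := by
    refine Set.eq_univ_of_forall fun θ => ⟨Real.sinh ((θ - θ₀) / 2), trivial, ?_⟩
    simp only [hf, Real.arsinh_sinh]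
    ring
  have h := integral_image_eq_integral_abs_deriv_smul MeasurableSet.univ hfd hinj
    (fun θ => G θ * Complex.exp (Complex.I * (τ * Real.cosh (θ - θ₀) : ℝ)))
  rw [himg, setIntegral_univ, setIntegral_univ] at h
  rw [h, ← integral_const_mul]
  congr 1 with y
  rw [abs_of_nonneg (by positivity), Complex.real_smul]
  have h1 : Real.cosh (f y - θ₀) = 1 + 2 * y ^ 2 := by
    simp only [hf, add_sub_cancel_left, cosh_two_mul_arsinh]
  have h2 : Complex.exp (Complex.I * (τ * Real.cosh (f y - θ₀) : ℝ)) =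
      Complex.exp (Complex.I * τ) * Complex.exp (Complex.I * (2 * τ * y ^ 2 : ℝ)) := by
    rw [h1, ← Complex.exp_add]
    congr 1
    push_cast
    ring
  rw [h2]
  ring

/-- Lower estimate, uniform in the location of the stationary point, for oscillatory integrals with
phase `τ cosh (θ - θ₀)`. -/
lemma exists_le_sqrt_mul_norm_integral_cosh {G : ℝ → ℂ} (hG : ContDiff ℝ 1 G)
    (hGc : HasCompactSupport G) :
    ∃ B : ℝ, 0 ≤ B ∧ ∀ θ₀ τ : ℝ, 1 ≤ 2 * τ →
      Real.sqrt Real.pi * ‖G θ₀‖ - B * quadraticRate (2 * τ) ≤ Real.sqrt (2 * τ) *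
        ‖∫ θ : ℝ, G θ * Complex.exp (Complex.I * (τ * Real.cosh (θ - θ₀) : ℝ))‖ := by
  obtain ⟨C₀, hC₀⟩ := hGc.exists_bound_of_continuous hG.continuous
  obtain ⟨C₁, hC₁⟩ := hGc.deriv.exists_bound_of_continuous (hG.continuous_deriv le_rfl)
  have hC₀' : 0 ≤ C₀ := (norm_nonneg _).trans (hC₀ 0)
  have hC₁' : 0 ≤ C₁ := (norm_nonneg _).trans (hC₁ 0)
  -- `18` comes from the quadratic case. The Jacobian `w` satisfies `w² = 4 / (1 + y²)` and `|w'| ≤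
  -- 2 / (1 + y²)`, which gives `4 C₁ + 2 C₀`, independent of `θ₀`.
  refine ⟨18 * (4 * C₁ + 2 * C₀), by positivity, fun θ₀ τ hτ => ?_⟩
  set w : ℝ → ℝ := fun y => 2 * (Real.sqrt (1 + y ^ 2))⁻¹ with hw
  set w' : ℝ → ℝ := fun y => -(2 * y * (Real.sqrt (1 + y ^ 2))⁻¹ * (1 + y ^ 2)⁻¹) with hw'
  set K : ℝ → ℂ := fun y => (w y : ℂ) * G (θ₀ + 2 * Real.arsinh y) with hK
  set K' : ℝ → ℂ := fun y => (w' y : ℂ) * G (θ₀ + 2 * Real.arsinh y) +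
    (w y : ℂ) * (w y • deriv G (θ₀ + 2 * Real.arsinh y)) with hK'
  have hTpos : ∀ y : ℝ, 0 < Real.sqrt (1 + y ^ 2) := fun y => by positivity
  have hTT : ∀ y : ℝ, Real.sqrt (1 + y ^ 2) ^ 2 = 1 + y ^ 2 := fun y =>
    Real.sq_sqrt (by positivity)
  have hwd : ∀ y, HasDerivAt w (w' y) y := fun y => by
    have h1 : HasDerivAt (fun y : ℝ => 1 + y ^ 2) (2 * y) y := by
      simpa using (hasDerivAt_pow 2 y).const_add 1
    refine (((h1.sqrt (by positivity)).inv (hTpos y).ne').const_mul 2).congr_deriv ?_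
    simp only [hw']
    rw [hTT]
    field_simp
  have hfd : ∀ y, HasDerivAt (fun y => θ₀ + 2 * Real.arsinh y) (w y) y := fun y =>
    ((Real.hasDerivAt_arsinh y).const_mul 2).const_add θ₀
  have hKd : ∀ y, HasDerivAt K (K' y) y := fun y =>
    (hwd y).ofReal_comp.mul
      (((hG.differentiable one_ne_zero).differentiableAt.hasDerivAt).scomp y (hfd y))
  have hcont : Continuous fun y : ℝ => (Real.sqrt (1 + y ^ 2))⁻¹ :=
    Continuous.inv₀ (by fun_prop) fun y => (hTpos y).ne'
  have hcont' : Continuous fun y : ℝ => (1 + y ^ 2)⁻¹ :=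
    Continuous.inv₀ (by fun_prop) fun y => by positivity
  have hwc : Continuous w := by fun_prop
  have hw'c : Continuous w' := by fun_prop
  have hfc : Continuous fun y => θ₀ + 2 * Real.arsinh y :=
    continuous_iff_continuousAt.mpr fun y => (hfd y).continuousAt
  have hK'c : Continuous K' := by
    have h1 : Continuous fun y => G (θ₀ + 2 * Real.arsinh y) := hG.continuous.comp hfc
    have h2 : Continuous fun y => deriv G (θ₀ + 2 * Real.arsinh y) :=
      (hG.continuous_deriv le_rfl).comp hfc
    have h3 : Continuous fun y => (w y : ℂ) := Complex.continuous_ofReal.comp hwc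
    have h4 : Continuous fun y => (w' y : ℂ) := Complex.continuous_ofReal.comp hw'c
    exact (h4.mul h1).add (h3.mul (hwc.smul h2))
  have hKc : Continuous K := continuous_iff_continuousAt.mpr fun y => (hKd y).continuousAt
  have hKs : HasCompactSupport K := by
    have h : HasCompactSupport fun y => G (θ₀ + 2 * Real.arsinh y) :=
      hGc.comp_homeomorph ((Real.sinhHomeomorph.symm.trans
        (Homeomorph.mulLeft₀ (2 : ℝ) two_ne_zero)).trans (Homeomorph.addLeft θ₀))
    exact h.mul_left
  have hwabs : ∀ y, |w y| = 2 * (Real.sqrt (1 + y ^ 2))⁻¹ := fun y =>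
    abs_of_nonneg (by positivity)
  have hKB : ∀ y, ‖K y‖ ≤ (4 * C₁ + 2 * C₀) * (Real.sqrt (1 + y ^ 2))⁻¹ := fun y => by
    simp only [hK]
    rw [norm_mul, Complex.norm_real, Real.norm_eq_abs, hwabs]
    calc _ ≤ 2 * (Real.sqrt (1 + y ^ 2))⁻¹ * C₀ := by gcongr; exact hC₀ _
      _ = (2 * C₀) * (Real.sqrt (1 + y ^ 2))⁻¹ := by ring
      _ ≤ _ := by gcongr; linarith
  have hK'B : ∀ y, ‖K' y‖ ≤ (4 * C₁ + 2 * C₀) * (1 + y ^ 2)⁻¹ := fun y => by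
    have h1 : |w' y| ≤ 2 * (1 + y ^ 2)⁻¹ := by
      simp only [hw']
      rw [abs_neg, abs_mul, abs_mul, abs_mul, abs_two, abs_inv, abs_inv,
        abs_of_pos (hTpos y), abs_of_pos (by positivity : (0 : ℝ) < 1 + y ^ 2)]
      refine mul_le_mul_of_nonneg_right ?_ (by positivity)
      rw [mul_assoc]
      refine mul_le_of_le_one_right zero_le_two ?_
      rw [← div_eq_mul_inv, div_le_one (hTpos y)]
      exact Real.abs_le_sqrt (by linarith)
    calc ‖K' y‖ ≤ |w' y| * ‖G (θ₀ + 2 * Real.arsinh y)‖ +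
          |w y| * (|w y| * ‖deriv G (θ₀ + 2 * Real.arsinh y)‖) := by
          refine (norm_add_le _ _).trans (le_of_eq ?_)
          rw [norm_mul, norm_mul, norm_smul, Complex.norm_real, Complex.norm_real,
            Real.norm_eq_abs, Real.norm_eq_abs]
      _ ≤ 2 * (1 + y ^ 2)⁻¹ * C₀ + |w y| * (|w y| * C₁) := by
          gcongr
          · exact hC₀ _
          · exact hC₁ _
      _ = (4 * C₁ + 2 * C₀) * (1 + y ^ 2)⁻¹ := by
          have hinv : (1 + y ^ 2)⁻¹ = (Real.sqrt (1 + y ^ 2))⁻¹ ^ 2 := by rw [inv_pow, hTT]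
          rw [hwabs, hinv]
          ring
  have hτ0 : 0 < 2 * τ := by linarith
  have hmain := sqrt_mul_norm_integral_sub_le hτ0 hKd hK'c (hKc.integrable_of_hasCompactSupport hKs)
    hKB hK'B
  have hmodel := sqrt_pi_div_two_le_sqrt_mul_norm hτ
  have hK0 : ‖K 0‖ = 2 * ‖G θ₀‖ := by
    simp [hK, hw]
  rw [integral_cosh_phase_eq, norm_mul, norm_exp_I_mul_ofReal_eq, one_mul]
  set J := ∫ y : ℝ, K y * Complex.exp (Complex.I * (2 * τ * y ^ 2 : ℝ)) with hJ
  set Z : ℂ := (Real.pi / (1 - Complex.I * (2 * τ : ℝ))) ^ (1 / 2 : ℂ) with hZ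
  have htri : ‖K 0 * Z‖ ≤ ‖J‖ + ‖J - K 0 * Z‖ := by
    have h := norm_sub_le J (J - K 0 * Z)
    rwa [sub_sub_cancel] at h
  rw [norm_mul, hK0] at htri
  have h1 := mul_le_mul_of_nonneg_left htri (Real.sqrt_nonneg (2 * τ))
  -- The Jacobian value `w 0 = 2` cancels the `1 / 2` of the model bound.
  have h2 := mul_le_mul_of_nonneg_left hmodel (by positivity : 0 ≤ 2 * ‖G θ₀‖)
  change _ ≤ Real.sqrt (2 * τ) * ‖J‖
  nlinarith

/-! ### The amplitude of `u_+` in the rapidity variable. -/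

/-- Strictness, which survives `a₁ = a₂` because `sinh θ ≠ 0`, makes the square root in the weight
smooth. -/
lemma coeff_arg_pos {a₁ a₂ θ : ℝ} (ha : a₁ ≤ a₂) (ha₂ : 0 < a₂) (hθ : θ ≠ 0) :
    0 < a₂ * Real.cosh θ ^ 2 - a₁ := by
  have h : 0 < Real.sinh θ ^ 2 := by
    have : Real.sinh θ ≠ 0 := by rwa [Ne, Real.sinh_eq_zero]
    positivity
  rw [Real.cosh_sq]
  nlinarith [mul_pos ha₂ h]

/-- The weight `q₁` in the variable `θ` given by `l = a₂ cosh² θ`. -/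
def rapidityWeight (a₁ a₂ θ : ℝ) : ℝ :=
  Real.sqrt (a₂ * Real.cosh θ ^ 2 - a₁) /
    (Real.sqrt (a₂ * Real.cosh θ ^ 2 - a₁) + Real.sqrt a₂ * Real.sinh θ) ^ 2

/-- The amplitude of `u_+` in the variable `θ > 0` given by `l = a₂ cosh² θ`, including the
Jacobian and extended by zero. -/
def amplitude (a₁ a₂ : ℝ) (ψ : ℝ → ℂ) (θ : ℝ) : ℂ :=
  if 0 < θ then
    ((2 * a₂ * Real.cosh θ * Real.sinh θ * rapidityWeight a₁ a₂ θ : ℝ) : ℂ) *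
      ψ (a₂ * Real.sinh θ ^ 2)
  else 0

/-- The half-open interval is the form needed to pass between the integral over `ℝ` and an interval
integral. -/
lemma support_amplitude_subset {a₁ a₂ α β : ℝ} (ha₂ : 0 < a₂) {ψ : ℝ → ℂ}
    (hψs : tsupport ψ ⊆ Set.Ioo α β) :
    Function.support (amplitude a₁ a₂ ψ) ⊆
      Set.Ioc (Real.arsinh (Real.sqrt (α / a₂))) (Real.arsinh (Real.sqrt (β / a₂))) := by
  intro θ hθ
  rw [Function.mem_support, amplitude] at hθ
  have hθ0 : 0 < θ := by
    by_contra h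
    simp [h] at hθ
  rw [if_pos hθ0] at hθ
  have hs : 0 < Real.sinh θ := Real.sinh_pos_iff.mpr hθ0
  have hmem := hψs (subset_tsupport _ (Function.mem_support.mpr (right_ne_zero_of_mul hθ)))
  rw [← Real.arsinh_sinh θ]
  constructor
  · rw [Real.arsinh_lt_arsinh, Real.sqrt_lt' hs, div_lt_iff₀ ha₂, mul_comm]
    exact hmem.1
  · rw [Real.arsinh_le_arsinh]
    apply Real.le_sqrt_of_sq_le
    rw [le_div_iff₀ ha₂, mul_comm]
    exact hmem.2.le

/-- As `α > 0`, the closed support stays away from `θ = 0`, so the extension by zero creates no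
singularity there. -/
lemma contDiff_amplitude {a₁ a₂ α β : ℝ} (ha : a₁ ≤ a₂) (ha₂ : 0 < a₂) (hα : 0 < α)
    {ψ : ℝ → ℂ} (hψ : ContDiff ℝ 1 ψ) (hψs : tsupport ψ ⊆ Set.Ioo α β) :
    ContDiff ℝ 1 (amplitude a₁ a₂ ψ) := by
  have hsub : tsupport (amplitude a₁ a₂ ψ) ⊆
      Set.Icc (Real.arsinh (Real.sqrt (α / a₂))) (Real.arsinh (Real.sqrt (β / a₂))) :=
    closure_minimal ((support_amplitude_subset ha₂ hψs).trans Set.Ioc_subset_Icc_self) isClosed_Icc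
  rw [contDiff_iff_contDiffAt]
  intro θ
  by_cases hmem : θ ∈ tsupport (amplitude a₁ a₂ ψ)
  · have hθ : 0 < θ := lt_of_lt_of_le
      (Real.arsinh_pos_iff.mpr (Real.sqrt_pos.mpr (by positivity))) (hsub hmem).1
    have hev : amplitude a₁ a₂ ψ =ᶠ[𝓝 θ] fun θ =>
        ((2 * a₂ * Real.cosh θ * Real.sinh θ * rapidityWeight a₁ a₂ θ : ℝ) : ℂ) *
          ψ (a₂ * Real.sinh θ ^ 2) := by
      filter_upwards [eventually_gt_nhds hθ] with z hz
      rw [amplitude, if_pos hz]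
    refine ContDiffAt.congr_of_eventuallyEq ?_ hev
    have hs : 0 < Real.sinh θ := Real.sinh_pos_iff.mpr hθ
    have harg : 0 < a₂ * Real.cosh θ ^ 2 - a₁ := coeff_arg_pos ha ha₂ hθ.ne'
    have hargd : ContDiff ℝ 1 fun θ => a₂ * Real.cosh θ ^ 2 - a₁ :=
      (contDiff_const.mul (Real.contDiff_cosh.pow 2)).sub contDiff_const
    have hT : ContDiffAt ℝ 1 (fun θ => Real.sqrt (a₂ * Real.cosh θ ^ 2 - a₁)) θ :=
      hargd.contDiffAt.sqrt harg.ne'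
    have hsinh : ContDiffAt ℝ 1 Real.sinh θ := Real.contDiff_sinh.contDiffAt
    have hcosh : ContDiffAt ℝ 1 Real.cosh θ := Real.contDiff_cosh.contDiffAt
    have hq : ContDiffAt ℝ 1 (rapidityWeight a₁ a₂) θ := by
      refine hT.div ((hT.add (contDiffAt_const.mul hsinh)).pow 2) ?_
      have := Real.sqrt_pos.mpr harg
      positivity
    have hr : ContDiffAt ℝ 1
        (fun θ => 2 * a₂ * Real.cosh θ * Real.sinh θ * rapidityWeight a₁ a₂ θ) θ :=
      ((contDiffAt_const.mul hcosh).mul hsinh).mul hq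
    have hψd : ContDiffAt ℝ 1 (fun θ => ψ (a₂ * Real.sinh θ ^ 2)) θ :=
      hψ.contDiffAt.comp θ (contDiffAt_const.mul (hsinh.pow 2))
    exact (Complex.ofRealCLM.contDiff.contDiffAt.comp θ hr).mul hψd
  · have hev : amplitude a₁ a₂ ψ =ᶠ[𝓝 θ] fun _ => 0 := notMem_tsupport_iff_eventuallyEq.mp hmem
    exact contDiffAt_const.congr_of_eventuallyEq hev

lemma hasCompactSupport_amplitude {a₁ a₂ α β : ℝ} (ha₂ : 0 < a₂) {ψ : ℝ → ℂ}
    (hψs : tsupport ψ ⊆ Set.Ioo α β) : HasCompactSupport (amplitude a₁ a₂ ψ) :=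
  HasCompactSupport.intro' isCompact_Icc isClosed_Icc fun _ h =>
    Function.notMem_support.mp fun h' =>
      h (Set.Ioc_subset_Icc_self (support_amplitude_subset ha₂ hψs h'))

lemma xi_of_le {c l : ℝ} (h : c ≤ l) : xi c l = (Real.sqrt (l - c) : ℂ) := if_pos h

lemma sqrt_mul_cosh_sq {a θ : ℝ} : Real.sqrt (a * Real.cosh θ ^ 2) = Real.sqrt a * Real.cosh θ := by
  rw [Real.sqrt_mul' _ (sq_nonneg _), Real.sqrt_sq (Real.cosh_pos θ).le]

lemma sqrt_mul_cosh_sq_sub {a θ : ℝ} (hθ : 0 ≤ θ) :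
    Real.sqrt (a * Real.cosh θ ^ 2 - a) = Real.sqrt a * Real.sinh θ := by
  rw [Real.cosh_sq, show a * (Real.sinh θ ^ 2 + 1) - a = a * Real.sinh θ ^ 2 by ring,
    Real.sqrt_mul' _ (sq_nonneg _), Real.sqrt_sq (Real.sinh_nonneg_iff.mpr hθ)]

lemma le_mul_cosh_sq {a θ : ℝ} (ha : 0 ≤ a) : a ≤ a * Real.cosh θ ^ 2 :=
  le_mul_of_one_le_right ha (one_le_pow₀ (Real.one_le_cosh θ))

/-- Above `a₂` both roots `ξ₁`, `ξ₂` are real and nonnegative, so the modulus of their sum is the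
sum itself. -/
lemma weight_mul_cosh_sq {a₁ a₂ θ : ℝ} (ha : a₁ ≤ a₂) (ha₂ : 0 < a₂) (hθ : 0 < θ) :
    weight ![a₁, a₂] 0 (a₂ * Real.cosh θ ^ 2) = rapidityWeight a₁ a₂ θ := by
  have harg : 0 < a₂ * Real.cosh θ ^ 2 - a₁ := coeff_arg_pos ha ha₂ hθ.ne'
  have hs : 0 < Real.sinh θ := Real.sinh_pos_iff.mpr hθ
  have h0 : (![a₁, a₂] : Fin 2 → ℝ) 0 = a₁ := rfl
  have h1 : (![a₁, a₂] : Fin 2 → ℝ) 1 = a₂ := rfl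
  rw [weight, h0, h1, if_pos (by linarith), xi_of_le (by linarith),
    xi_of_le (le_mul_cosh_sq ha₂.le), sqrt_mul_cosh_sq_sub hθ.le, ← Complex.ofReal_add,
    Complex.norm_real, Real.norm_of_nonneg (by positivity), rapidityWeight]

/-- `u_+` as an oscillatory integral with phase proportional to `cosh (θ - θ₀)`, where
`(t, x) = ρ (cosh θ₀, sinh θ₀)`. -/
lemma uPlus_eq_integral_cosh {a₁ a₂ α β : ℝ} (ha : a₁ ≤ a₂) (ha₂ : 0 < a₂) (hα : 0 < α)
    (hαβ : α ≤ β) {ψ : ℝ → ℂ} (hψs : tsupport ψ ⊆ Set.Ioo α β) {w : ℝ → ℂ}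
    (hw : ∀ l, w l = ψ (l - a₂)) (ρ θ₀ : ℝ) :
    uPlus a₁ a₂ (a₂ + α) (a₂ + β) w (ρ * Real.cosh θ₀) (ρ * Real.sinh θ₀) =
      ∫ θ : ℝ, amplitude a₁ a₂ ψ θ *
        Complex.exp (Complex.I * (Real.sqrt a₂ * ρ * Real.cosh (θ - θ₀) : ℝ)) := by
  set θ₁ := Real.arsinh (Real.sqrt (α / a₂)) with hθ₁
  set θ₂ := Real.arsinh (Real.sqrt (β / a₂)) with hθ₂
  have hβ : 0 < β := hα.trans_le hαβ
  have hθ₁0 : 0 < θ₁ := Real.arsinh_pos_iff.mpr (Real.sqrt_pos.mpr (by positivity))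
  have hle : θ₁ ≤ θ₂ := Real.arsinh_le_arsinh.mpr (Real.sqrt_le_sqrt (by gcongr))
  have hend : ∀ γ : ℝ, 0 < γ →
      a₂ * Real.cosh (Real.arsinh (Real.sqrt (γ / a₂))) ^ 2 = a₂ + γ := fun γ hγ => by
    rw [Real.cosh_sq, Real.sinh_arsinh, Real.sq_sqrt (by positivity)]
    field_simp
    ring
  have hder : ∀ θ, HasDerivAt (fun θ => a₂ * Real.cosh θ ^ 2)
      (2 * a₂ * Real.cosh θ * Real.sinh θ) θ := fun θ => by
    refine (((Real.hasDerivAt_cosh θ).pow 2).const_mul a₂).congr_deriv ?_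
    simp; ring
  have hsub := intervalIntegral.integral_deriv_smul_comp_of_deriv_nonneg (a := θ₁) (b := θ₂)
    (f := fun θ => a₂ * Real.cosh θ ^ 2) (f' := fun θ => 2 * a₂ * Real.cosh θ * Real.sinh θ)
    (g := fun l => Complex.exp (Complex.I * Real.sqrt l * (ρ * Real.cosh θ₀ : ℝ)) *
      (weight ![a₁, a₂] 0 l : ℂ) *
      Complex.exp (-Complex.I * xi a₂ l * (ρ * Real.sinh θ₀ : ℝ)) * w l)
    (fun θ _ => (hder θ).continuousAt.continuousWithinAt) (fun θ _ => hder θ)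
    (fun θ hθ => by
      rw [min_eq_left hle] at hθ
      have := Real.sinh_pos_iff.mpr (hθ₁0.trans hθ.1)
      positivity)
  rw [hend α hα, hend β hβ] at hsub
  rw [uPlus, ← hsub]
  have hsupp : Function.support (fun θ : ℝ => amplitude a₁ a₂ ψ θ *
      Complex.exp (Complex.I * (Real.sqrt a₂ * ρ * Real.cosh (θ - θ₀) : ℝ))) ⊆
      Set.Ioc θ₁ θ₂ :=
    (Function.support_mul_subset_left _ _).trans (support_amplitude_subset ha₂ hψs)
  rw [← intervalIntegral.integral_eq_integral_of_support_subset hsupp]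
  refine intervalIntegral.integral_congr fun θ hθ => ?_
  rw [Set.uIcc_of_le hle] at hθ
  have hθ0 : 0 < θ := hθ₁0.trans_le hθ.1
  simp only [Function.comp_apply]
  rw [amplitude, if_pos hθ0, weight_mul_cosh_sq ha ha₂ hθ0, hw, xi_of_le (le_mul_cosh_sq ha₂.le),
    sqrt_mul_cosh_sq, sqrt_mul_cosh_sq_sub hθ0.le, Complex.real_smul,
    show a₂ * Real.cosh θ ^ 2 - a₂ = a₂ * Real.sinh θ ^ 2 by rw [Real.cosh_sq]; ring]
  have hphase : Complex.exp (Complex.I * (Real.sqrt a₂ * ρ * Real.cosh (θ - θ₀) : ℝ)) =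
      Complex.exp (Complex.I * (Real.sqrt a₂ * Real.cosh θ : ℝ) * (ρ * Real.cosh θ₀ : ℝ)) *
      Complex.exp (-Complex.I * (Real.sqrt a₂ * Real.sinh θ : ℝ) * (ρ * Real.sinh θ₀ : ℝ)) := by
    rw [← Complex.exp_add, Real.cosh_sub]
    congr 1
    push_cast
    ring
  rw [hphase]
  push_cast
  ring

/-! ### The cone and the coefficient `H` in hyperbolic coordinates. -/

/-- Points of the cone in hyperbolic coordinates. -/
lemma InCone.exists_rapidity {a₂ α β t x : ℝ} (ha₂ : 0 < a₂) (hα : 0 < α) (hβ : 0 < β)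
    (h : InCone a₂ α β t x) :
    ∃ ρ θ : ℝ, 0 < ρ ∧ 0 < θ ∧ t = ρ * Real.cosh θ ∧ x = ρ * Real.sinh θ ∧
      α ≤ a₂ * Real.sinh θ ^ 2 ∧ a₂ * Real.sinh θ ^ 2 ≤ β := by
  obtain ⟨ht, hx, hlow, hupp⟩ := h
  have hr : 0 < t / x := div_pos ht hx
  have h1 : (a₂ + β) / β ≤ (t / x) ^ 2 := (Real.sqrt_le_left hr.le).mp hlow
  have h2 : (t / x) ^ 2 ≤ (a₂ + α) / α :=
    (Real.le_sqrt hr.le (by positivity)).mp hupp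
  rw [div_pow, div_le_div_iff₀ hβ (by positivity)] at h1
  rw [div_pow, div_le_div_iff₀ (by positivity) hα] at h2
  -- The lower bound on `t / x` reads `a₂ x² ≤ β (t² - x²)`. It yields both timelikeness and the
  -- upper bound `a₂ sinh² θ ≤ β`; the roles of the two bounds are exchanged.
  have hpos : 0 < t ^ 2 - x ^ 2 := by
    have : 0 < a₂ * x ^ 2 := by positivity
    by_contra hneg
    nlinarith
  set ρ := Real.sqrt (t ^ 2 - x ^ 2) with hρ
  have hρ0 : 0 < ρ := Real.sqrt_pos.mpr hpos
  have hρ2 : ρ ^ 2 = t ^ 2 - x ^ 2 := Real.sq_sqrt hpos.le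
  refine ⟨ρ, Real.arsinh (x / ρ), hρ0, Real.arsinh_pos_iff.mpr (by positivity), ?_, ?_, ?_, ?_⟩
  · rw [Real.cosh_arsinh, show 1 + (x / ρ) ^ 2 = (t / ρ) ^ 2 by field_simp; linarith,
      Real.sqrt_sq (by positivity)]
    field_simp
  · rw [Real.sinh_arsinh]
    field_simp
  · rw [Real.sinh_arsinh, div_pow, hρ2, ← mul_div_assoc, le_div_iff₀ hpos]
    linarith
  · rw [Real.sinh_arsinh, div_pow, hρ2, ← mul_div_assoc, div_le_iff₀ hpos]
    linarith

section Rapidity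

variable {a₁ a₂ ρ θ : ℝ}

lemma mul_cosh_div_mul_sinh (hρ : 0 < ρ) :
    ρ * Real.cosh θ / (ρ * Real.sinh θ) = Real.cosh θ / Real.sinh θ :=
  mul_div_mul_left _ _ hρ.ne'

lemma sq_cosh_div_sinh_sub_one (hθ : 0 < θ) :
    (Real.cosh θ / Real.sinh θ) ^ 2 - 1 = (Real.sinh θ ^ 2)⁻¹ := by
  have hs : 0 < Real.sinh θ := Real.sinh_pos_iff.mpr hθ
  rw [div_pow, Real.cosh_sq]
  field_simp
  ring

lemma p0_rapidity (ha₂ : 0 < a₂) (hρ : 0 < ρ) :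
    p0 a₂ (ρ * Real.cosh θ) (ρ * Real.sinh θ) ^ 2 = a₂ * Real.sinh θ ^ 2 := by
  have h : (ρ * Real.cosh θ) ^ 2 - (ρ * Real.sinh θ) ^ 2 = ρ ^ 2 := by
    rw [mul_pow, mul_pow, Real.cosh_sq]; ring
  rw [p0, h, Real.sq_sqrt (by positivity)]
  field_simp

lemma h1_rapidity (hρ : 0 < ρ) (hθ : 0 < θ) :
    h1 (ρ * Real.cosh θ) (ρ * Real.sinh θ) = (Real.cosh θ ^ 2) ^ (3 / 4 : ℝ) := by
  have hs : 0 < Real.sinh θ := Real.sinh_pos_iff.mpr hθ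
  rw [h1, mul_cosh_div_mul_sinh hρ, sq_cosh_div_sinh_sub_one hθ]
  congr 1
  field_simp

lemma sqrt_arg_rapidity (hθ : 0 < θ) :
    Real.sqrt ((a₂ - a₁) * (Real.sinh θ ^ 2)⁻¹ + a₂) =
      Real.sqrt (a₂ * Real.cosh θ ^ 2 - a₁) / Real.sinh θ := by
  have hs : 0 < Real.sinh θ := Real.sinh_pos_iff.mpr hθ
  rw [show (a₂ - a₁) * (Real.sinh θ ^ 2)⁻¹ + a₂ =
      (a₂ * Real.cosh θ ^ 2 - a₁) / Real.sinh θ ^ 2 by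
    rw [Real.cosh_sq]; field_simp; ring, Real.sqrt_div' _ (sq_nonneg _), Real.sqrt_sq hs.le]

lemma h2_rapidity (ha : a₁ ≤ a₂) (ha₂ : 0 < a₂) (hρ : 0 < ρ) (hθ : 0 < θ) :
    h2 a₁ a₂ (ρ * Real.cosh θ) (ρ * Real.sinh θ) = Real.sinh θ * rapidityWeight a₁ a₂ θ := by
  have hs : 0 < Real.sinh θ := Real.sinh_pos_iff.mpr hθ
  have hT := Real.sqrt_pos.mpr (coeff_arg_pos ha ha₂ hθ.ne')
  rw [h2, mul_cosh_div_mul_sinh hρ, sq_cosh_div_sinh_sub_one hθ, sqrt_arg_rapidity hθ,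
    rapidityWeight]
  field_simp

lemma norm_coeffH_rapidity (ha : a₁ ≤ a₂) (ha₂ : 0 < a₂) (hρ : 0 < ρ) (hθ : 0 < θ) (w : ℝ → ℂ) :
    ‖coeffH a₁ a₂ w (ρ * Real.cosh θ) (ρ * Real.sinh θ)‖ =
      Real.sqrt (2 * Real.pi) * a₂ ^ (3 / 4 : ℝ) * (Real.cosh θ ^ 2) ^ (3 / 4 : ℝ) *
        (Real.sinh θ * rapidityWeight a₁ a₂ θ) * ‖w (a₂ + a₂ * Real.sinh θ ^ 2)‖ := by
  have hs : 0 < Real.sinh θ := Real.sinh_pos_iff.mpr hθ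
  have hexp : ∀ r : ℝ, ‖Complex.exp (-Complex.I * r)‖ = 1 := fun r => by
    have := norm_exp_I_mul_ofReal_eq (-r)
    rwa [Complex.ofReal_neg, mul_neg, ← neg_mul] at this
  have hroot : ‖((2 * Complex.I * Real.pi) ^ (1 / 2 : ℂ) : ℂ)‖ = Real.sqrt (2 * Real.pi) := by
    rw [show (1 / 2 : ℂ) = ((1 / 2 : ℝ) : ℂ) by push_cast; rfl, Complex.norm_cpow_real,
      Real.sqrt_eq_rpow]
    simp [abs_of_pos Real.pi_pos]
  have hq : 0 ≤ Real.sinh θ * rapidityWeight a₁ a₂ θ := by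
    rw [rapidityWeight]; positivity
  simp only [coeffH]
  rw [norm_mul, norm_mul, norm_mul, norm_mul, norm_mul, hexp, hroot, p0_rapidity ha₂ hρ,
    h1_rapidity hρ hθ, h2_rapidity ha ha₂ hρ hθ, Complex.norm_real, Complex.norm_real,
    Complex.norm_real, Real.norm_of_nonneg (by positivity), Real.norm_of_nonneg (by positivity),
    Real.norm_of_nonneg hq, one_mul]

/-- The coefficient `H` is half of the leading coefficient produced by stationary phase. -/
lemma norm_coeffH_eq_amplitude (ha : a₁ ≤ a₂) (ha₂ : 0 < a₂) (hρ : 0 < ρ) (hθ : 0 < θ)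
    {w ψ : ℝ → ℂ} (hw : ∀ l, w l = ψ (l - a₂)) :
    ‖coeffH a₁ a₂ w (ρ * Real.cosh θ) (ρ * Real.sinh θ)‖ =
      Real.sqrt (Real.cosh θ / (2 * Real.sqrt a₂)) *
        (Real.sqrt Real.pi * ‖amplitude a₁ a₂ ψ θ‖) := by
  have hs : 0 < Real.sinh θ := Real.sinh_pos_iff.mpr hθ
  have hc : 0 < Real.cosh θ := Real.cosh_pos θ
  have hq : 0 ≤ rapidityWeight a₁ a₂ θ := by rw [rapidityWeight]; positivity
  rw [norm_coeffH_rapidity ha ha₂ hρ hθ, amplitude, if_pos hθ, norm_mul, Complex.norm_real,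
    Real.norm_of_nonneg (by positivity), hw, add_sub_cancel_left]
  have hkey : Real.sqrt (2 * Real.pi) * a₂ ^ (3 / 4 : ℝ) * (Real.cosh θ ^ 2) ^ (3 / 4 : ℝ) =
      Real.sqrt (Real.cosh θ / (2 * Real.sqrt a₂)) * Real.sqrt Real.pi *
        (2 * a₂ * Real.cosh θ) := by
    have hpow : ∀ z : ℝ, 0 < z → (z ^ (3 / 4 : ℝ)) ^ 2 = z * Real.sqrt z := fun z hz => by
      rw [← Real.rpow_natCast, ← Real.rpow_mul hz.le, Real.sqrt_eq_rpow, ← Real.rpow_one_add' hz.le]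
      all_goals norm_num
    have hA : Real.sqrt a₂ ^ 2 = a₂ := Real.sq_sqrt ha₂.le
    have hA0 : 0 < Real.sqrt a₂ := Real.sqrt_pos.mpr ha₂
    -- Squaring turns the powers `3 / 4` into `z √z`.
    refine (pow_left_inj₀ (by positivity) (by positivity) two_ne_zero).mp ?_
    simp only [mul_pow]
    rw [hpow a₂ ha₂, hpow _ (by positivity), Real.sqrt_sq hc.le, Real.sq_sqrt (by positivity),
      Real.sq_sqrt (by positivity), Real.sq_sqrt (by positivity)]
    field_simp
    rw [hA]
  rw [hkey]
  ring

/-- Factoring `√a₂ sinh θ` out of the root exposes the shape of `lowerConst`, with `p₀² = a₂ sinh²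
θ` in place of `α`. -/
lemma sinh_mul_rapidityWeight (ha₂ : 0 < a₂) (hθ : 0 < θ) :
    Real.sinh θ * rapidityWeight a₁ a₂ θ =
      1 / Real.sqrt a₂ * Real.sqrt ((a₂ - a₁) / (a₂ * Real.sinh θ ^ 2) + 1) *
        ((Real.sqrt ((a₂ - a₁) / (a₂ * Real.sinh θ ^ 2) + 1) + 1) ^ 2)⁻¹ := by
  have hs : 0 < Real.sinh θ := Real.sinh_pos_iff.mpr hθ
  have hA0 : 0 < Real.sqrt a₂ := Real.sqrt_pos.mpr ha₂
  have hT : Real.sqrt (a₂ * Real.cosh θ ^ 2 - a₁) = Real.sqrt a₂ * Real.sinh θ *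
      Real.sqrt ((a₂ - a₁) / (a₂ * Real.sinh θ ^ 2) + 1) := by
    rw [show a₂ * Real.cosh θ ^ 2 - a₁ =
        a₂ * Real.sinh θ ^ 2 * ((a₂ - a₁) / (a₂ * Real.sinh θ ^ 2) + 1) by
      rw [Real.cosh_sq]; field_simp; ring, Real.sqrt_mul (by positivity),
      Real.sqrt_mul ha₂.le, Real.sqrt_sq hs.le]
  have hS : 0 ≤ Real.sqrt ((a₂ - a₁) / (a₂ * Real.sinh θ ^ 2) + 1) := Real.sqrt_nonneg _
  rw [rapidityWeight, hT]
  field_simp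

end Rapidity

/-! ### Lower bound for `H` and asymptotics of the constant. -/

/-- After cross-multiplication the difference of the two sides is `(r s - 1)(s - r)`. -/
lemma mul_inv_add_one_sq_anti {r s : ℝ} (hr : 1 ≤ r) (hrs : r ≤ s) :
    s * ((s + 1) ^ 2)⁻¹ ≤ r * ((r + 1) ^ 2)⁻¹ := by
  have hs : 1 ≤ s := hr.trans hrs
  rw [← div_eq_mul_inv, ← div_eq_mul_inv, div_le_div_iff₀ (by positivity) (by positivity)]
  have h : 0 ≤ (r * s - 1) * (s - r) :=
    mul_nonneg (by nlinarith) (by linarith)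
  nlinarith

lemma lowerConst_mul_le_norm_coeffH {a₁ a₂ α m ρ θ : ℝ} (ha : a₁ ≤ a₂) (ha₂ : 0 < a₂) (hα : 0 < α)
    (hm : 0 ≤ m) (hρ : 0 < ρ) (hθ : 0 < θ) (hαθ : α ≤ a₂ * Real.sinh θ ^ 2) {w : ℝ → ℂ}
    (hw : m ≤ ‖w (a₂ + a₂ * Real.sinh θ ^ 2)‖) :
    lowerConst a₁ a₂ α * m ≤ ‖coeffH a₁ a₂ w (ρ * Real.cosh θ) (ρ * Real.sinh θ)‖ := by
  rw [norm_coeffH_rapidity ha ha₂ hρ hθ, sinh_mul_rapidityWeight ha₂ hθ, lowerConst]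
  set p := a₂ * Real.sinh θ ^ 2 with hp
  have hp0 : 0 < p := hα.trans_le hαθ
  have hd : 0 ≤ a₂ - a₁ := by linarith
  have hfrac : α / a₂ + 1 ≤ Real.cosh θ ^ 2 := by
    rw [Real.cosh_sq, add_le_add_iff_right, div_le_iff₀ ha₂, mul_comm]
    exact hαθ
  have hS1 : 1 ≤ Real.sqrt ((a₂ - a₁) / p + 1) := by
    rw [Real.one_le_sqrt]
    linarith [div_nonneg hd hp0.le]
  have hS2 : Real.sqrt ((a₂ - a₁) / p + 1) ≤ Real.sqrt ((a₂ - a₁) / α + 1) := by gcongr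
  have hmono := mul_inv_add_one_sq_anti hS1 hS2
  calc _ = Real.sqrt (2 * Real.pi) * a₂ ^ (3 / 4 : ℝ) * (α / a₂ + 1) ^ (3 / 4 : ℝ) *
        (1 / Real.sqrt a₂ * (Real.sqrt ((a₂ - a₁) / α + 1) *
          ((Real.sqrt ((a₂ - a₁) / α + 1) + 1) ^ 2)⁻¹)) * m := by ring
    _ ≤ Real.sqrt (2 * Real.pi) * a₂ ^ (3 / 4 : ℝ) * (Real.cosh θ ^ 2) ^ (3 / 4 : ℝ) *
        (1 / Real.sqrt a₂ * (Real.sqrt ((a₂ - a₁) / p + 1) *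
          ((Real.sqrt ((a₂ - a₁) / p + 1) + 1) ^ 2)⁻¹)) * ‖w (a₂ + p)‖ := by gcongr
    _ = _ := by ring

lemma tendsto_const_div_add_one (c : ℝ) :
    Tendsto (fun a : ℝ => c / a + 1) atTop (𝓝 1) := by
  simpa using (tendsto_const_nhds (x := c)).div_atTop tendsto_id |>.add_const 1

/-- With `S = √((a - a₁)/α + 1)`, the factor `S / (S + 1)²` behaves like `1 / S`, hence like `√(α /
a)`; the remaining powers of `a` combine to `a^(1/4)`. The quotient is split exactly into three
factors tending to 1. -/
lemma lowerConst_isEquivalent (a₁ : ℝ) {α : ℝ} (hα : 0 < α) :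
    (fun a : ℝ => lowerConst a₁ a α) ~[atTop]
      fun a : ℝ => Real.sqrt (2 * Real.pi * α) * a ^ (-(1 / 4) : ℝ) := by
  refine isEquivalent_of_tendsto_one ?_
  set S : ℝ → ℝ := fun a => Real.sqrt ((a - a₁) / α + 1) with hS
  have hStop : Tendsto S atTop atTop := by
    refine Real.tendsto_sqrt_atTop.comp (tendsto_atTop_add_const_right _ _ ?_)
    exact (tendsto_atTop_add_const_right _ (-a₁) tendsto_id).atTop_div_const hα
  have hpow : Tendsto (fun a : ℝ => (α / a + 1) ^ (3 / 4 : ℝ)) atTop (𝓝 1) := by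
    simpa using (tendsto_const_div_add_one α).rpow_const (p := 3 / 4) (Or.inl one_ne_zero)
  have hfrac : Tendsto (fun a : ℝ => Real.sqrt (((α - a₁) / a + 1)⁻¹)) atTop (𝓝 1) := by
    simpa using ((tendsto_const_div_add_one (α - a₁)).inv₀ one_ne_zero).sqrt
  have hSfrac : Tendsto (fun a : ℝ => ((1 / S a + 1) ^ 2)⁻¹) atTop (𝓝 1) := by
    simpa using (((tendsto_const_div_add_one 1).comp hStop).pow 2).inv₀ (by norm_num)
  have hlim : Tendsto (fun a : ℝ => (α / a + 1) ^ (3 / 4 : ℝ) *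
      Real.sqrt (((α - a₁) / a + 1)⁻¹) * ((1 / S a + 1) ^ 2)⁻¹) atTop (𝓝 1) := by
    simpa using (hpow.mul hfrac).mul hSfrac
  refine hlim.congr' ?_
  filter_upwards [eventually_gt_atTop 0, eventually_gt_atTop a₁] with a ha ha'
  have harg : 0 < (a - a₁) / α + 1 := by
    have := div_pos (sub_pos.mpr ha') hα
    linarith
  have hSpos : 0 < S a := Real.sqrt_pos.mpr harg
  have hroot : Real.sqrt (((α - a₁) / a + 1)⁻¹) = Real.sqrt a / (Real.sqrt α * S a) := by
    rw [hS, ← Real.sqrt_mul hα.le, ← Real.sqrt_div ha.le]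
    congr 1
    rw [show α * ((a - a₁) / α + 1) = a - a₁ + α by field_simp,
      show (α - a₁) / a + 1 = (a - a₁ + α) / a by field_simp; ring, inv_div]
  have hquarter : a ^ (3 / 4 : ℝ) = Real.sqrt a * Real.sqrt a * a ^ (-(1 / 4) : ℝ) := by
    rw [Real.mul_self_sqrt ha.le, ← Real.rpow_one_add' ha.le]
    all_goals norm_num
  have h4 : 0 < a ^ (-(1 / 4) : ℝ) := Real.rpow_pos_of_pos ha _
  have h5 : 0 < Real.sqrt a := Real.sqrt_pos.mpr ha
  have h6 : 0 < Real.sqrt α := Real.sqrt_pos.mpr hα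
  have h7 : 0 < Real.sqrt (2 * Real.pi) := by positivity
  simp only [Pi.div_apply, lowerConst]
  rw [hroot, hquarter, Real.sqrt_mul (by positivity : 0 ≤ 2 * Real.pi)]
  change _ = Real.sqrt (2 * Real.pi) * _ * _ * _ * S a * ((S a + 1) ^ 2)⁻¹ / _
  field_simp
  ring

/-! ### Lower bound for `u_+`. -/

lemma lowerConst_sub_mul_le_norm_uPlus {a₁ a₂ α β α' β' m : ℝ} (ha : a₁ ≤ a₂) (ha₂ : 0 < a₂)
    (hα : 0 < α) (hαα' : α ≤ α') (hαβ : α ≤ β) (hβ'0 : 0 < β') (hm : 0 ≤ m) {ψ w : ℝ → ℂ}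
    (hψ : ContDiff ℝ 1 ψ) (hψs : tsupport ψ ⊆ Set.Ioo α β) (hw : ∀ l, w l = ψ (l - a₂))
    (hψm : ∀ μ ∈ Set.Icc α' β', m ≤ ‖ψ μ‖) {ε : ℝ} (hε : 0 < ε) :
    ∃ t₀ : ℝ, 0 < t₀ ∧ ∀ t : ℝ, t₀ < t → ∀ x : ℝ, InCone a₂ α' β' t x →
      (lowerConst a₁ a₂ α * m - ε) * t ^ (-(1 / 2) : ℝ) ≤
        ‖uPlus a₁ a₂ (a₂ + α) (a₂ + β) w t x‖ := by
  obtain ⟨B, hB, hmain⟩ := exists_le_sqrt_mul_norm_integral_cosh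
    (contDiff_amplitude (a₁ := a₁) ha ha₂ hα hψ hψs) (hasCompactSupport_amplitude ha₂ hψs)
  -- An upper bound for `cosh θ = t / ρ` on the cone, which lets large `t` force a large parameter
  -- `σ = 2 √a₂ ρ` uniformly in `x`.
  set D := Real.sqrt (β' / a₂ + 1) with hD
  have hD0 : 0 < D := by positivity
  have hA0 : 0 < Real.sqrt a₂ := Real.sqrt_pos.mpr ha₂
  set c := Real.sqrt (D / (2 * Real.sqrt a₂)) with hc
  have hlim : Tendsto (fun σ => c * (B * quadraticRate σ)) atTop (𝓝 0) := by
    simpa using (tendsto_quadraticRate.const_mul B).const_mul c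
  obtain ⟨σ₁, hσ₁⟩ := eventually_atTop.mp (hlim.eventually (gt_mem_nhds hε))
  -- Beyond `σ₁` the error is below `ε`; the `1` secures `σ ≥ 1`, required by the model bound.
  refine ⟨D * max σ₁ 1 / (2 * Real.sqrt a₂), by positivity, fun t ht x hcone => ?_⟩
  obtain ⟨ρ, θ, hρ, hθ, rfl, rfl, hlow, hupp⟩ :=
    hcone.exists_rapidity ha₂ (hα.trans_le hαα') hβ'0
  have hcosh : 0 < Real.cosh θ := Real.cosh_pos θ
  have hcD : Real.cosh θ ≤ D := by
    apply Real.le_sqrt_of_sq_le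
    rw [Real.cosh_sq, add_le_add_iff_right, le_div_iff₀ ha₂, mul_comm]
    exact hupp
  have hσ : max σ₁ 1 ≤ 2 * (Real.sqrt a₂ * ρ) := by
    rw [div_lt_iff₀ (by positivity)] at ht
    have h1 : D * max σ₁ 1 ≤ D * (2 * (Real.sqrt a₂ * ρ)) := by
      calc D * max σ₁ 1 ≤ ρ * Real.cosh θ * (2 * Real.sqrt a₂) := ht.le
        _ = Real.cosh θ * (2 * (Real.sqrt a₂ * ρ)) := by ring
        _ ≤ _ := by gcongr
    exact le_of_mul_le_mul_left h1 hD0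
  have herr := hσ₁ _ ((le_max_left _ _).trans hσ)
  have hest := hmain θ (Real.sqrt a₂ * ρ) ((le_max_right _ _).trans hσ)
  rw [← uPlus_eq_integral_cosh ha ha₂ hα hαβ hψs hw] at hest
  set σ := 2 * (Real.sqrt a₂ * ρ) with hσdef
  set U := ‖uPlus a₁ a₂ (a₂ + α) (a₂ + β) w (ρ * Real.cosh θ) (ρ * Real.sinh θ)‖ with hU
  set k := Real.sqrt (Real.cosh θ / (2 * Real.sqrt a₂)) with hk
  have hkc : k ≤ c := by rw [hk, hc]; gcongr
  have hHlow := lowerConst_mul_le_norm_coeffH (w := w) ha ha₂ hα hm hρ hθ (hαα'.trans hlow)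
    (by rw [hw, add_sub_cancel_left]; exact hψm _ ⟨hlow, hupp⟩)
  rw [norm_coeffH_eq_amplitude ha ha₂ hρ hθ hw, ← hk] at hHlow
  -- The factor `k` relating `|H|` to the amplitude is the same one that converts decay in `σ` into
  -- decay in `t`.
  have hroot : k * Real.sqrt σ = Real.sqrt (ρ * Real.cosh θ) := by
    rw [hk, ← Real.sqrt_mul (by positivity)]
    congr 1
    rw [hσdef]
    field_simp
  have ht0 : 0 < ρ * Real.cosh θ := by positivity
  have hfinal : lowerConst a₁ a₂ α * m - ε ≤ Real.sqrt (ρ * Real.cosh θ) * U := by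
    have h1 := mul_le_mul_of_nonneg_left hest (Real.sqrt_nonneg (Real.cosh θ / (2 * Real.sqrt a₂)))
    have h2 : k * (B * quadraticRate σ) ≤ c * (B * quadraticRate σ) :=
      mul_le_mul_of_nonneg_right hkc (mul_nonneg hB (quadraticRate_nonneg σ))
    rw [← hk] at h1
    rw [← hroot, mul_assoc]
    linarith
  rw [Real.rpow_neg ht0.le, ← Real.sqrt_eq_rpow, ← div_eq_mul_inv,
    div_le_iff₀ (Real.sqrt_pos.mpr ht0)]
  linarith

end KleinGordon

end

theorem theorem4p1
    (a₁ a₂ : ℝ) (ha₁ : 0 ≤ a₁) (ha₁₂ : a₁ ≤ a₂) (ha₂ : 0 < a₂)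
    (α β : ℝ) (hα : 0 < α) (hαβ : α < β) (hβ : β < 1)
    (ψ : ℝ → ℂ) (hψ : ContDiff ℝ 2 ψ) (hψc : HasCompactSupport ψ)
    (hψs : tsupport ψ ⊆ Set.Ioo α β)
    (hψn : IsLUB (Set.range fun μ => ‖ψ μ‖) 1)
    (u₀ : KleinGordon.StateSpace) (Vu₀ : Fin 2 → ℝ → ℂ)
    (hV : KleinGordon.IsTransform ![a₁, a₂] u₀ Vu₀)
    (hV₁ : ∀ l, Vu₀ 0 l = ψ (l - a₂)) (hV₂ : ∀ l, Vu₀ 1 l = 0)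
    (α' β' m : ℝ) (hα' : α < α') (hα'β' : α' < β') (hβ' : β' < β) (hm : 0 < m)
    (hψm : ∀ μ ∈ Set.Icc α' β', m ≤ (ψ μ).re ∧ (ψ μ).im = 0) :
    (∀ t x : ℝ, KleinGordon.InCone a₂ α' β' t x →
      KleinGordon.lowerConst a₁ a₂ α * m ≤ ‖KleinGordon.coeffH a₁ a₂ (Vu₀ 0) t x‖) ∧
    ((fun a : ℝ => KleinGordon.lowerConst a₁ a α) ~[atTop]
      (fun a : ℝ => Real.sqrt (2 * Real.pi * α) * a ^ (-(1 / 4) : ℝ))) ∧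
    (∀ ε : ℝ, 0 < ε → ∃ t₀ : ℝ, 0 < t₀ ∧ ∀ t : ℝ, t₀ < t → ∀ x : ℝ,
      KleinGordon.InCone a₂ α' β' t x →
      (KleinGordon.lowerConst a₁ a₂ α * m - ε) * t ^ (-(1 / 2) : ℝ) ≤
        ‖KleinGordon.uPlus a₁ a₂ (a₂ + α) (a₂ + β) (Vu₀ 0) t x‖) := by
  have hψm' : ∀ μ ∈ Set.Icc α' β', m ≤ ‖ψ μ‖ := fun μ hμ =>
    (hψm μ hμ).1.trans (Complex.re_le_norm _)
  have hα'0 : 0 < α' := hα.trans hα'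
  have hβ'0 : 0 < β' := hα'0.trans hα'β'
  refine ⟨fun t x hcone => ?_, KleinGordon.lowerConst_isEquivalent a₁ hα, fun ε hε =>
    KleinGordon.lowerConst_sub_mul_le_norm_uPlus ha₁₂ ha₂ hα hα'.le hαβ.le hβ'0 hm.le
      (hψ.of_le one_le_two) hψs hV₁ hψm' hε⟩
  obtain ⟨ρ, θ, hρ, hθ, rfl, rfl, hlow, hupp⟩ := hcone.exists_rapidity ha₂ hα'0 hβ'0
  refine KleinGordon.lowerConst_mul_le_norm_coeffH ha₁₂ ha₂ hα hm.le hρ hθ (hα'.le.trans hlow) ?_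
  rw [hV₁, add_sub_cancel_left]
  exact hψm' _ ⟨hlow, hupp⟩
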